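/- Let $f:\mathbb{C}[x,y]\to\mathbb{C}[x,y]$ be a $\mathbb{C}$-algebra endomorphism and put $p:=f(x)$, $q:=f(y)$. Suppose that the Jacobian $\mathrm{Jac}(p,q)=\frac{\partial p}{\partial x}\frac{\partial q}{\partial y}-\frac{\partial p}{\partial y}\frac{\partial q}{\partial x}$ is a nonzero constant. Let $u\in\mathbb{C}[p,q,x]\setminus\{0\}$ and $v\in\mathbb{C}[p,q]\setminus\{0\}$ be such that $y=u/v$ in $\mathbb{C}(x,y)$. Write $v=c\,v_1\cdots v_m$ with $c\in\mathbb{C}^*$, $m\ge 0$, and $v_1,\ldots,v_m$ irreducible elements of the ring $\mathbb{C}[p,q]$. If every $v_j$ is also irreducible in $\mathbb{C}[x,y]$, then the group of invertible elements of the subring $\mathbb{C}[p,q,x][1/v]$ of $\mathbb{C}(x,y)$ is contained in $\mathbb{C}(p,q)\setminus\{0\}$, and $f$ is an automorphism of $\mathbb{C}[x,y]$. -/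

import Mathlib

noncomputable section

namespace JacPlane

/-- The polynomial ring `ℂ[x, y]`, with `x = X 0` and `y = X 1`. -/
abbrev Poly : Type := MvPolynomial (Fin 2) ℂ

/-- The variable `x`. -/
abbrev x : Poly := MvPolynomial.X 0

/-- The variable `y`. -/
abbrev y : Poly := MvPolynomial.X 1

/-- The field of rational functions `ℂ(x, y)`. -/
abbrev RatFun : Type := FractionRing Poly

/-- The inclusion `ℂ[x, y] ⊆ ℂ(x, y)`. -/
abbrev toRatFun (g : Poly) : RatFun := algebraMap Poly RatFun g

/-- The Jacobian `Jac(p, q) = det (∂(p, q) / ∂(x, y))`. -/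
def jac (p q : Poly) : Poly :=
  Matrix.det
    !![MvPolynomial.pderiv 0 p, MvPolynomial.pderiv 1 p;
       MvPolynomial.pderiv 0 q, MvPolynomial.pderiv 1 q]

/-- The subalgebra `ℂ[p, q]` of `ℂ[x, y]`. -/
abbrev polyPQ (p q : Poly) : Subalgebra ℂ Poly := Algebra.adjoin ℂ {p, q}

/-- The subalgebra `ℂ[p, q, x]` of `ℂ[x, y]`. -/
abbrev polyPQX (p q : Poly) : Subalgebra ℂ Poly := Algebra.adjoin ℂ {p, q, x}

/-- The subfield `ℂ(p, q)` of `ℂ(x, y)`. -/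
def ratPQ (p q : Poly) : IntermediateField ℂ RatFun :=
  IntermediateField.adjoin ℂ {toRatFun p, toRatFun q}

/-- The subalgebra `ℂ[p, q, x][1/v]` of `ℂ(x, y)`. -/
def polyPQXInv (p q v : Poly) : Subalgebra ℂ RatFun :=
  Algebra.adjoin ℂ {toRatFun p, toRatFun q, toRatFun x, (toRatFun v)⁻¹}

/-- The unit condition: the group of invertible elements of `ℂ[p, q, x][1/v]` is contained in
`ℂ(p, q) - 0`. -/
def UnitCondition (p q v : Poly) : Prop :=
  ∀ a : (polyPQXInv p q v)ˣ,
    ((a : polyPQXInv p q v) : RatFun) ∈ (ratPQ p q : Set RatFun) \ {0}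

end JacPlane

end

namespace JacPlane

open MvPolynomial

/-! The factors of `v` stay prime in `ℂ[x, y]`, so every divisor of a power of `v` is a constant
times a product of them and lies in `ℂ[p, q]` (`mem_of_dvd_pow`). A unit of `ℂ[p, q, x][1/v]`,
multiplied by a power of `v`, becomes such a divisor; this gives the unit condition.

For surjectivity, let `G` generate the ideal of relations of `x` over `ℂ[p, q]`, a factorial ring
because `f` is injective. The Jacobian condition and `y = u/v` make `G'(x)` a divisor of a power of
`v` (`evalX_derivative_dvd_pow`), so `G'(x)` is some element of `ℂ[p, q]`. As `G'` minus that
element has smaller degree than `G`, it vanishes identically; in characteristic zero `G` is then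
linear. Hence `x`, and with it `y = u/v`, lies in `ℂ(p, q)`, and Keller's theorem
(`surjective_of_birational`) concludes. -/

/-! ### Derivations attached to a Jacobian pair, and injectivity of `f`. -/

theorem eq_C_of_pderiv_eq_zero {g : Poly} (h : ∀ i, pderiv i g = 0) : ∃ c, g = C c := by
  refine ⟨coeff 0 g, MvPolynomial.ext _ _ fun m => ?_⟩
  rw [coeff_C]
  split_ifs with hm
  · rw [hm]
  · obtain ⟨i, hi⟩ : ∃ i, m i ≠ 0 := by
      by_contra! hcon
      exact hm (Finsupp.ext fun i => (hcon i).symm)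
    have hle : Finsupp.single i 1 ≤ m := by
      rw [Finsupp.single_le_iff]; omega
    have := coeff_pderiv (i := i) g (m - Finsupp.single i 1)
    rw [h i, coeff_zero, tsub_add_cancel_of_le hle] at this
    rcases mul_eq_zero.1 this.symm with h0 | h0
    · exact h0
    · exfalso
      exact Nat.cast_add_one_ne_zero _ h0

theorem totalDegree_pderiv_lt {g : Poly} {i : Fin 2} (h : pderiv i g ≠ 0) :
    (pderiv i g).totalDegree < g.totalDegree := by
  obtain ⟨m, hm, hdeg⟩ := Finset.exists_mem_eq_sup (pderiv i g).support
    (support_nonempty.2 h) (fun s => s.sum fun _ e => e)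
  have hdeg' : (pderiv i g).totalDegree = m.sum fun _ e => e := hdeg
  have hc : coeff (m + Finsupp.single i 1) g ≠ 0 := by
    intro h0
    have := coeff_pderiv (i := i) g m
    rw [h0, zero_mul] at this
    exact (mem_support_iff.1 hm) this
  have := le_totalDegree (mem_support_iff.2 hc)
  rw [Finsupp.sum_add_index' (by simp) (by simp), Finsupp.sum_single_index rfl] at this
  omega

theorem isUnit_iff_exists_C {g : Poly} : IsUnit g ↔ ∃ c : ℂ, c ≠ 0 ∧ g = C c := by
  rw [isUnit_iff_eq_C_of_isReduced]
  simp [isUnit_iff_ne_zero]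

/-- The derivation `∂/∂p` of `ℂ[x, y]` attached to a Jacobian pair `(p, q)` with `Jac = lam`. -/
noncomputable def ddp (lam : ℂ) (q : Poly) : Derivation ℂ Poly Poly :=
  (C lam⁻¹ : Poly) • (pderiv 1 q • pderiv 0 - pderiv 0 q • pderiv 1)

theorem ddp_apply (lam : ℂ) (q b : Poly) :
    ddp lam q b = C lam⁻¹ * (pderiv 1 q * pderiv 0 b - pderiv 0 q * pderiv 1 b) := by
  simp [ddp]

theorem jac_eq (p q : Poly) :
    jac p q = pderiv 0 p * pderiv 1 q - pderiv 1 p * pderiv 0 q := by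
  simp [jac, Matrix.det_fin_two_of]

theorem ddp_eq_one {lam : ℂ} (hlam : lam ≠ 0) {p q : Poly} (hJ : jac p q = C lam) :
    ddp lam q p = 1 := by
  have h : pderiv 1 q * pderiv 0 p - pderiv 0 q * pderiv 1 p = C lam := by
    rw [← hJ, jac_eq]; ring
  rw [ddp_apply, h, ← C_mul, inv_mul_cancel₀ hlam, C_1]

theorem ddp_eq_zero (lam : ℂ) (q : Poly) : ddp lam q q = 0 := by
  rw [ddp_apply]; ring

theorem jac_swap {p q : Poly} {lam : ℂ} (hJ : jac p q = C lam) : jac q p = C (-lam) := by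
  rw [C_neg, ← hJ, jac_eq, jac_eq]; ring

/-- Chain rule for a derivation along an endomorphism. -/
theorem derivation_comp (f : Poly →ₐ[ℂ] Poly) (D : Derivation ℂ Poly Poly) (a : Poly) :
    D (f a) = f (pderiv 0 a) * D (f x) + f (pderiv 1 a) * D (f y) := by
  induction a using MvPolynomial.induction_on with
  | C r =>
    have : f (C r) = C r := f.commutes r
    rw [this]
    have h2 : D (C r) = 0 := D.map_algebraMap r
    simp [h2]
  | add a b ha hb => simp only [map_add, ha, hb]; ring
  | mul_X a i ha =>
    simp only [map_mul, Derivation.leibniz, smul_eq_mul, ha, map_add]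
    fin_cases i
    · have h1 : pderiv (R := ℂ) (0 : Fin 2) (X 0) = 1 := pderiv_X_self 0
      have h2 : pderiv (R := ℂ) (1 : Fin 2) (X 0) = 0 := pderiv_X_of_ne (by decide)
      simp only [Fin.zero_eta, h1, h2, map_one, map_zero]; ring
    · have h1 : pderiv (R := ℂ) (1 : Fin 2) (X 1) = 1 := pderiv_X_self 1
      have h2 : pderiv (R := ℂ) (0 : Fin 2) (X 1) = 0 := pderiv_X_of_ne (by decide)
      simp only [Fin.mk_one, h1, h2, map_one, map_zero]; ring

theorem ddp_comp {f : Poly →ₐ[ℂ] Poly} {lam : ℂ} (hlam : lam ≠ 0)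
    (hJ : jac (f x) (f y) = C lam) (a : Poly) : ddp lam (f y) (f a) = f (pderiv 0 a) := by
  rw [derivation_comp, ddp_eq_one hlam hJ, ddp_eq_zero]; ring

/-- Exchanging `p` and `q` changes the sign of the Jacobian, so `∂/∂q` is `ddp` with parameter
`-lam`. -/
theorem ddq_comp {f : Poly →ₐ[ℂ] Poly} {lam : ℂ} (hlam : lam ≠ 0)
    (hJ : jac (f x) (f y) = C lam) (a : Poly) : ddp (-lam) (f x) (f a) = f (pderiv 1 a) := by
  rw [derivation_comp, ddp_eq_one (neg_ne_zero.2 hlam) (jac_swap hJ), ddp_eq_zero]; ring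

/-- By the chain rule the kernel is stable under both partial derivatives; these lower the degree,
so descent ends at a constant, which `f` fixes. -/
theorem injective_of_jac {f : Poly →ₐ[ℂ] Poly} {lam : ℂ} (hlam : lam ≠ 0)
    (hJ : jac (f x) (f y) = C lam) : Function.Injective f := by
  rw [injective_iff_map_eq_zero]
  have key : ∀ (n : ℕ) (a : Poly), a.totalDegree < n → f a = 0 → a = 0 := by
    intro n
    induction n with
    | zero => intro a h; omega
    | succ n ih =>
      intro a hn ha
      have h0 : f (pderiv 0 a) = 0 := by rw [← ddp_comp hlam hJ, ha, map_zero]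
      have h1 : f (pderiv 1 a) = 0 := by rw [← ddq_comp hlam hJ, ha, map_zero]
      have hz : ∀ i, f (pderiv i a) = 0 → pderiv i a = 0 := by
        intro i hi
        by_contra hne
        exact hne (ih _ (by have := totalDegree_pderiv_lt hne; omega) hi)
      obtain ⟨c, rfl⟩ := eq_C_of_pderiv_eq_zero (g := a)
        (Fin.forall_fin_two.2 ⟨hz 0 h0, hz 1 h1⟩)
      exact (f.commutes c).symm.trans ha
  exact fun a => key _ a (Nat.lt_succ_self _)

/-! ### The equation of `x` over `ℂ[p, q]` and its derivative. -/

/-- A prime ideal of polynomials over a factorial domain that contracts to zero is principal. -/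
theorem exists_ker_generator {R S : Type*} [CommRing R] [IsDomain R] [UniqueFactorizationMonoid R]
    [CommRing S] [IsDomain S] (φ : Polynomial R →+* S)
    (hC : ∀ r, φ (Polynomial.C r) = 0 → r = 0) (hφ : ¬ Function.Injective φ) :
    ∃ G : Polynomial R, Prime G ∧ G.natDegree ≠ 0 ∧ ∀ H, φ H = 0 ↔ G ∣ H := by
  let _ : NormalizedGCDMonoid R := Nonempty.some inferInstance
  have hker : RingHom.ker φ ≠ ⊥ := fun h => hφ ((RingHom.injective_iff_ker_eq_bot φ).2 h)
  obtain ⟨G, hG, hGp⟩ := (RingHom.ker_isPrime φ).exists_mem_prime_of_ne_bot hker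
  rw [RingHom.mem_ker] at hG
  have hdeg : G.natDegree ≠ 0 := by
    intro h0
    rw [Polynomial.eq_C_of_natDegree_eq_zero h0] at hG
    apply hGp.ne_zero
    rw [Polynomial.eq_C_of_natDegree_eq_zero h0, hC _ hG, Polynomial.C_0]
  refine ⟨G, hGp, hdeg, fun H => ⟨fun hH => ?_, fun ⟨K, hK⟩ => by rw [hK, map_mul, hG, zero_mul]⟩⟩
  have hprim : G.IsPrimitive := hGp.irreducible.isPrimitive hdeg
  let K := FractionRing R
  by_contra hndvd
  have hirr := (hprim.irreducible_iff_irreducible_map_fraction_map (K := K)).1 hGp.irreducible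
  have hcop : IsCoprime (G.map (algebraMap R K)) (H.map (algebraMap R K)) := by
    exact (hirr.coprime_iff_not_dvd).2 fun h =>
      hndvd ((hprim.dvd_iff_fraction_map_dvd_fraction_map K).2 h)
  obtain ⟨a, b, hab⟩ := hcop
  obtain ⟨d, hd, hda⟩ := IsLocalization.integerNormalization_spec (nonZeroDivisors R) a
  obtain ⟨e, he, heb⟩ := IsLocalization.integerNormalization_spec (nonZeroDivisors R) b
  have hd0 := nonZeroDivisors.ne_zero hd
  have he0 := nonZeroDivisors.ne_zero he
  set a' := IsLocalization.integerNormalization (nonZeroDivisors R) a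
  set b' := IsLocalization.integerNormalization (nonZeroDivisors R) b
  -- Clearing denominators in the Bézout relation puts the nonzero constant `d * e` in the kernel.
  have hcomb : Polynomial.C e * a' * G + Polynomial.C d * b' * H = Polynomial.C (d * e) := by
    apply Polynomial.map_injective (algebraMap R K) (IsFractionRing.injective R K)
    simp only [Polynomial.map_add, Polynomial.map_mul, Polynomial.map_C, hda, heb,
      Algebra.smul_def, map_mul]
    have h1 : algebraMap R (Polynomial K) d = Polynomial.C (algebraMap R K d) := rfl
    have h2 : algebraMap R (Polynomial K) e = Polynomial.C (algebraMap R K e) := rfl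
    rw [h1, h2]
    linear_combination (Polynomial.C (algebraMap R K d) * Polynomial.C (algebraMap R K e)) * hab
  have := congrArg φ hcomb
  rw [map_add, map_mul φ _ G, map_mul φ _ H, hG, hH, mul_zero, mul_zero, add_zero] at this
  exact mul_ne_zero hd0 he0 (hC _ this.symm)

/-- A derivation of `ℂ[X, Y][T]` along a homomorphism is determined by its values at the
variables. -/
theorem twisted_derivation_eq {S : Type*} [CommRing S] (φ : Polynomial Poly →+* S)
    (E : Polynomial Poly → S) (hadd : ∀ a b, E (a + b) = E a + E b)
    (hmul : ∀ a b, E (a * b) = φ a * E b + φ b * E a)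
    (hc : ∀ r : ℂ, E (Polynomial.C (C r)) = 0) (hX : ∀ i, E (Polynomial.C (X i)) = 0)
    (H : Polynomial Poly) :
    E H = φ (Polynomial.derivative H) * E Polynomial.X := by
  have hC : ∀ a : Poly, E (Polynomial.C a) = 0 := by
    intro a
    induction a using MvPolynomial.induction_on with
    | C r => exact hc r
    | add a b ha hb => rw [Polynomial.C_add, hadd, ha, hb, add_zero]
    | mul_X a i ha => rw [Polynomial.C_mul, hmul, ha, hX]; ring
  induction H using Polynomial.induction_on with
  | C a => rw [hC]; simp
  | add a b ha hb => rw [hadd, ha, hb, Polynomial.derivative_add, map_add]; ring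
  | monomial n a ih =>
    rw [pow_succ, ← mul_assoc]
    generalize Polynomial.C a * Polynomial.X ^ n = b at ih ⊢
    rw [hmul, ih, Polynomial.derivative_mul, Polynomial.derivative_X, mul_one, map_add φ,
      map_mul φ]
    ring

/-- The source has transcendence degree 3 over `ℂ`, the target 2. -/
theorem not_injective_of_polynomial (φ : Polynomial Poly →ₐ[ℂ] Poly) :
    ¬ Function.Injective φ := by
  intro h
  have h3 := trdeg_le_of_injective (φ.comp (finSuccEquiv ℂ 2).toAlgHom)
    (h.comp (finSuccEquiv ℂ 2).injective)
  rw [MvPolynomial.trdeg_of_isDomain, MvPolynomial.trdeg_of_isDomain] at h3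
  simp at h3
  norm_cast at h3

/-- The evaluation `ℂ[X, Y][T] → ℂ[x, y]` given by `f` on `ℂ[X, Y]` and by `T ↦ x`. -/
noncomputable def evalX (f : Poly →ₐ[ℂ] Poly) : Polynomial Poly →ₐ[ℂ] Poly :=
  Polynomial.eval₂AlgHom f x fun _ => Commute.all _ _

@[simp] theorem evalX_C (f : Poly →ₐ[ℂ] Poly) (a : Poly) : evalX f (Polynomial.C a) = f a := by
  simp [evalX]

@[simp] theorem evalX_X (f : Poly →ₐ[ℂ] Poly) : evalX f Polynomial.X = x := by
  simp [evalX]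

/-- If `y` lies in `f(ℂ[X, Y])[x][1 / f(V)]` and `Jac(f(x), f(y))` is a nonzero constant, then the
derivative at `x` of the equation of `x` over `f(ℂ[X, Y])` divides a power of `f(V)`. -/
theorem evalX_derivative_dvd_pow {f : Poly →ₐ[ℂ] Poly} {lam : ℂ} (hlam : lam ≠ 0)
    (hJ : jac (f x) (f y) = C lam) {G : Polynomial Poly} (hG0 : G ≠ 0)
    (hG : ∀ H, evalX f H = 0 ↔ G ∣ H) {V : Poly} (hV : f V ≠ 0) {U : Polynomial Poly}
    (hU : evalX f U = f V * y) :
    ∃ n, evalX f (Polynomial.derivative G) ∣ f V ^ n := by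
  have hCV : (Polynomial.C V : Polynomial Poly) ≠ 0 := by
    rw [Ne, Polynomial.C_eq_zero]
    rintro rfl
    exact hV (map_zero f)
  let S := Localization.Away (Polynomial.C V : Polynomial Poly)
  let ι : Polynomial Poly →+* S := algebraMap _ S
  have hM : Submonoid.powers (Polynomial.C V : Polynomial Poly) ≤
      nonZeroDivisors (Polynomial Poly) :=
    powers_le_nonZeroDivisors_of_noZeroDivisors hCV
  have : IsDomain S := IsLocalization.isDomain_localization hM
  have hι : Function.Injective ι := IsLocalization.injective S hM
  let κ : Poly →+* RatFun := algebraMap Poly RatFun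
  have hκ : Function.Injective κ := IsFractionRing.injective Poly RatFun
  let φ : Polynomial Poly →+* RatFun := κ.comp (evalX f : Polynomial Poly →+* Poly)
  have hφ : ∀ H, φ H = κ (evalX f H) := fun _ => rfl
  have hφV : φ (Polynomial.C V) = κ (f V) := by rw [hφ, evalX_C]
  have hκV : κ (f V) ≠ 0 := (map_ne_zero_iff κ hκ).2 hV
  have hunit : IsUnit (φ (Polynomial.C V)) := by rw [hφV]; exact hκV.isUnit
  let ψ : S →+* RatFun := IsLocalization.Away.lift (Polynomial.C V : Polynomial Poly) hunit
  have hψ : ∀ H, ψ (ι H) = φ H := IsLocalization.Away.lift_eq _ hunit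
  let inv : S := IsLocalization.Away.invSelf (Polynomial.C V : Polynomial Poly)
  have hinv : ι (Polynomial.C V) * inv = 1 := IsLocalization.Away.mul_invSelf _
  -- Since `y = U(x)/v`, the inclusion of `ℂ[x, y]` in `ℂ(x, y)` lifts through `ψ`, whose kernel is
  -- generated by `G`.
  let σ : Poly →+* S := eval₂Hom ((ι.comp Polynomial.C).comp C) ![ι Polynomial.X, ι U * inv]
  have hσC : ∀ r, σ (C r) = ι (Polynomial.C (C r)) := fun r => eval₂Hom_C _ _ _
  have hσx : σ x = ι Polynomial.X := eval₂Hom_X' _ _ _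
  have hσy : σ y = ι U * inv := eval₂Hom_X' _ _ _
  have hψσ : ∀ b, ψ (σ b) = κ b := by
    intro b
    suffices h : ψ.comp σ = κ from congrArg (fun g : Poly →+* RatFun => g b) h
    refine MvPolynomial.ringHom_ext (fun r => ?_) (Fin.forall_fin_two.2 ⟨?_, ?_⟩)
    · rw [RingHom.comp_apply, hσC, hψ, hφ, evalX_C]
      exact congrArg κ (f.commutes r)
    · rw [RingHom.comp_apply, hσx, hψ, hφ, evalX_X]
    · have h1 : κ (f V) * ψ inv = 1 := by rw [← hφV, ← hψ, ← map_mul, hinv, map_one]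
      rw [RingHom.comp_apply, hσy, map_mul, hψ, hφ, hU, map_mul]
      linear_combination κ y * h1
  have hsurj : ∀ s : S, ∃ n H, s * ι (Polynomial.C V) ^ n = ι H :=
    IsLocalization.Away.surj (Polynomial.C V : Polynomial Poly)
  have hψker : ∀ s, ψ s = 0 → ∃ t, s = ι G * t := by
    intro s hs
    obtain ⟨n, H, h⟩ := hsurj s
    have h0 : κ (evalX f H) = 0 := by rw [← hφ, ← hψ, ← h, map_mul, hs, zero_mul]
    obtain ⟨K, rfl⟩ := (hG H).1 ((map_eq_zero_iff κ hκ).1 h0)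
    refine ⟨ι K * inv ^ n, ?_⟩
    rw [← mul_assoc, ← map_mul, ← h, mul_assoc, ← mul_pow, hinv, one_pow, mul_one]
  let τ : Polynomial Poly →+* S := σ.comp (evalX f : Polynomial Poly →+* Poly)
  have hτ : ∀ H, τ H = σ (evalX f H) := fun _ => rfl
  have hψτ : ∀ H, ψ (τ H) = φ H := fun H => by rw [hτ, hψσ, hφ]
  -- `τ` and `ι` agree modulo `G`; their difference divided by `G` is a derivation twisted by the
  -- two maps, and `ψ` makes both twists equal to `φ`.
  have hex : ∀ H, ∃ t, τ H - ι H = ι G * t := fun H =>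
    hψker _ (by rw [map_sub, hψτ, hψ, sub_self])
  choose d hd using hex
  have hιG : ι G ≠ 0 := (map_ne_zero_iff ι hι).2 hG0
  have hdadd : ∀ a b, d (a + b) = d a + d b := fun a b =>
    mul_left_cancel₀ hιG (by rw [mul_add, ← hd, ← hd, ← hd, map_add, map_add]; ring)
  have hdmul : ∀ a b, d (a * b) = τ a * d b + ι b * d a := fun a b =>
    mul_left_cancel₀ hιG (by
      rw [← hd, map_mul, map_mul]
      linear_combination τ a * hd b + ι b * hd a)
  have hdz : ∀ a, τ a = ι a → d a = 0 := fun a ha =>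
    mul_left_cancel₀ hιG (by rw [← hd, ha, sub_self, mul_zero])
  have hdC : ∀ r : ℂ, d (Polynomial.C (C r)) = 0 := fun r => hdz _ (by
    rw [hτ, evalX_C, ← hσC]; exact congrArg σ (f.commutes r))
  have hdT : d Polynomial.X = 0 := hdz _ (by rw [hτ, evalX_X, hσx])
  -- `τ` kills `G`, so `τ G - ι G = ι G * (-1)`.
  have hdG : d G = -1 := mul_left_cancel₀ hιG (by
    rw [← hd, hτ, (hG G).2 dvd_rfl, map_zero]; ring)
  -- The combination of `∂/∂p` and `∂/∂q` that takes the values of `ψ ∘ d` at `p` and `q`. Hence `D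
  -- ∘ evalX f - ψ ∘ d` vanishes on coefficients; evaluating it at `G` gives `1 = G'(x) * D x`.
  let D : Poly → RatFun := fun b =>
    ψ (d (Polynomial.C x)) * κ (ddp lam (f y) b) + ψ (d (Polynomial.C y)) * κ (ddp (-lam) (f x) b)
  have hlam' : -lam ≠ 0 := neg_ne_zero.2 hlam
  have hE := twisted_derivation_eq φ (fun H => D (evalX f H) - ψ (d H))
    (fun a b => by simp only [D, map_add, hdadd]; ring)
    (fun a b => by
      simp only [D, map_mul, map_add, hdmul, Derivation.leibniz, smul_eq_mul, hψ, hψτ, hφ]; ring)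
    (fun r => by
      have h : evalX f (Polynomial.C (C r)) = algebraMap ℂ Poly r := by
        rw [evalX_C]; exact f.commutes r
      simp only [D, h, hdC, Derivation.map_algebraMap, map_zero]; ring)
    (Fin.forall_fin_two.2 ⟨by
      simp only [D, evalX_C, ddp_eq_one hlam hJ, ddp_eq_zero, map_zero, map_one]; ring, by
      simp only [D, evalX_C, ddp_eq_one hlam' (jac_swap hJ), ddp_eq_zero, map_zero, map_one]; ring⟩)
    G
  simp only [(hG G).2 dvd_rfl, hdG, hdT, evalX_X, map_neg, map_one, map_zero, sub_zero] at hE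
  have hD0 : D 0 = 0 := by simp only [D, map_zero]; ring
  -- The denominators of `D x` are powers of `f V`; clearing them gives the divisibility.
  obtain ⟨k, K, hK⟩ := hsurj (d (Polynomial.C x))
  obtain ⟨l, K', hL⟩ := hsurj (d (Polynomial.C y))
  replace hK := congrArg ψ hK
  replace hL := congrArg ψ hL
  rw [map_mul, map_pow, hψ, hψ, hφV, hφ] at hK hL
  refine ⟨k + l, evalX f K * f V ^ l * ddp lam (f y) x + evalX f K' * f V ^ k * ddp (-lam) (f x) x,
    hκ ?_⟩
  rw [hD0, hφ] at hE
  simp only [D] at hE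
  simp only [map_pow, map_mul, map_add, pow_add, ← hK, ← hL]
  linear_combination (κ (f V) ^ k * κ (f V) ^ l) * hE

/-! ### Divisors of powers of `v`. -/

theorem mem_of_dvd_mul {A : Subalgebra ℂ Poly} {g h : Poly} (hg : ∀ b, b ∣ g → b ∈ A)
    (hh : ∀ b, b ∣ h → b ∈ A) : ∀ b, b ∣ g * h → b ∈ A := by
  intro b hb
  obtain ⟨b₁, b₂, h₁, h₂, rfl⟩ := exists_dvd_and_dvd_of_dvd_mul hb
  exact A.mul_mem (hg _ h₁) (hh _ h₂)

theorem mem_of_isUnit {A : Subalgebra ℂ Poly} {b : Poly} (hb : IsUnit b) : b ∈ A := by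
  obtain ⟨c, -, rfl⟩ := isUnit_iff_exists_C.1 hb
  exact A.algebraMap_mem c

/-- A subalgebra contains the divisors of every power of a product of its irreducible elements. -/
theorem mem_of_dvd_pow {A : Subalgebra ℂ Poly} {c : ℂ} (hc : c ≠ 0) {m : ℕ} {w : Fin m → Poly}
    (hw : ∀ j, Irreducible (w j)) (hwA : ∀ j, w j ∈ A) (n : ℕ) :
    ∀ b, b ∣ (C c * ∏ j, w j) ^ n → b ∈ A := by
  have hone : ∀ b, b ∣ (1 : Poly) → b ∈ A := fun b hb => mem_of_isUnit (isUnit_of_dvd_one hb)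
  have hprod : ∀ b, b ∣ ∏ j, w j → b ∈ A := by
    refine Finset.prod_induction w (fun g => ∀ b, b ∣ g → b ∈ A)
      (fun _ _ => mem_of_dvd_mul) hone fun j _ b hb => ?_
    rcases (hw j).dvd_iff.1 hb with h | h
    · exact mem_of_isUnit h
    · obtain ⟨e, he⟩ := h
      rw [← he]
      exact A.mul_mem (hwA j) (mem_of_isUnit e.isUnit)
  have hCc : ∀ b, b ∣ (C c : Poly) → b ∈ A := fun b hb =>
    mem_of_isUnit (isUnit_of_dvd_unit hb (isUnit_iff_exists_C.2 ⟨c, hc, rfl⟩))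
  induction n with
  | zero => simpa using hone
  | succ n ih => rw [pow_succ]; exact mem_of_dvd_mul ih (mem_of_dvd_mul hCc hprod)

/-! ### Keller's theorem for birational endomorphisms. -/

/-- A prime ideal of `ℂ[x, y]` that contains two relatively prime elements, one of them nonzero and
not a unit, is the ideal of a point. -/
theorem exists_X_sub_C_mem {Q : Ideal Poly} [hQ : Q.IsPrime] {a d : Poly} (hd0 : d ≠ 0)
    (had : IsRelPrime a d) (ha : a ∈ Q) (hd : d ∈ Q) :
    ∃ α : Fin 2 → ℂ, ∀ i, X i - C (α i) ∈ Q := by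
  obtain ⟨e, he, hed, heQ⟩ : ∃ e, Prime e ∧ e ∣ d ∧ e ∈ Q := by
    obtain ⟨s, hs, hsd⟩ := UniqueFactorizationMonoid.exists_prime_factors d hd0
    have hsQ : s.prod ∈ Q := by
      obtain ⟨t, ht⟩ := hsd.symm
      rw [← ht]
      exact Q.mul_mem_right _ hd
    obtain ⟨e, hes, heQ⟩ := (hQ.multiset_prod_mem_iff_exists_mem s).1 hsQ
    exact ⟨e, hs e hes, (Multiset.dvd_prod hes).trans hsd.dvd, heQ⟩
  have hmax : Q.IsMaximal := by
    obtain ⟨M, hM, hQM⟩ := Q.exists_le_maximal hQ.ne_top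
    rcases hQM.eq_or_lt with rfl | hlt
    · exact hM
    exfalso
    have heprime : (Ideal.span {e}).IsPrime := (Ideal.span_singleton_prime he.ne_zero).2 he
    have hleQ : Ideal.span {e} ≤ Q := (Ideal.span_singleton_le_iff_mem _).2 heQ
    -- If equality held, `e` would be a common factor of `a` and `d`.
    have hltQ : Ideal.span {e} < Q := by
      refine hleQ.lt_of_ne ?_
      rintro rfl
      exact he.not_isUnit (had (Ideal.mem_span_singleton.1 ha) hed)
    have hbot : (⊥ : Ideal Poly) < Ideal.span {e} := by
      rw [bot_lt_iff_ne_bot, Ne, Ideal.span_singleton_eq_bot]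
      exact he.ne_zero
    let P0 : PrimeSpectrum Poly := ⟨⊥, Ideal.isPrime_bot⟩
    let P1 : PrimeSpectrum Poly := ⟨_, heprime⟩
    let P2 : PrimeSpectrum Poly := ⟨Q, hQ⟩
    let P3 : PrimeSpectrum Poly := ⟨M, hM.isPrime⟩
    have h01 : P0 < P1 := hbot
    have h12 : P1 < P2 := hltQ
    have h23 : P2 < P3 := hlt
    -- A non-maximal `Q` would give a chain of primes of length 3 in a ring of dimension 2.
    let c : LTSeries (PrimeSpectrum Poly) :=
      { length := 3
        toFun := ![P0, P1, P2, P3]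
        step := by
          intro i
          fin_cases i
          exacts [h01, h12, h23] }
    have h := Order.LTSeries.length_le_krullDim c
    have hdim : Order.krullDim (PrimeSpectrum Poly) = 2 := by
      have := MvPolynomial.ringKrullDim_of_isNoetherianRing (R := ℂ) (ι := Fin 2)
      rw [ringKrullDim_eq_zero_of_field] at this
      simpa [ringKrullDim] using this
    rw [hdim] at h
    change ((3 : ℕ) : WithBot ℕ∞) ≤ (2 : ℕ) at h
    norm_cast at h
  obtain ⟨α, hα⟩ := (MvPolynomial.isMaximal_iff_eq_vanishingIdeal_singleton (K := ℂ)).1 hmax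
  refine ⟨α, fun i => ?_⟩
  rw [hα, mem_vanishingIdeal_singleton_iff]
  simp

/-- Keller's theorem in the birational case. -/
theorem surjective_of_birational {f : Poly →ₐ[ℂ] Poly} {lam : ℂ} (hlam : lam ≠ 0)
    (hJ : jac (f x) (f y) = C lam) (hx : ∃ a d, d ≠ 0 ∧ f d * x = f a)
    (hy : ∃ a d, d ≠ 0 ∧ f d * y = f a) : Function.Surjective f := by
  have hinj := injective_of_jac hlam hJ
  have hall : ∀ b, ∃ a d, d ≠ 0 ∧ f d * b = f a := by
    intro b
    induction b using MvPolynomial.induction_on with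
    | C r => exact ⟨C r, 1, one_ne_zero, by rw [map_one, one_mul]; exact (f.commutes r).symm⟩
    | add b b' hb hb' =>
      obtain ⟨a, d, hd, h⟩ := hb
      obtain ⟨a', d', hd', h'⟩ := hb'
      refine ⟨a * d' + a' * d, d * d', mul_ne_zero hd hd', ?_⟩
      simp only [map_add, map_mul, ← h, ← h']; ring
    | mul_X b i hb =>
      have hi : ∃ a d, d ≠ 0 ∧ f d * X i = f a := by
        revert i; exact Fin.forall_fin_two.2 ⟨hx, hy⟩
      obtain ⟨a, d, hd, h⟩ := hb
      obtain ⟨a', d', hd', h'⟩ := hi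
      refine ⟨a * a', d * d', mul_ne_zero hd hd', ?_⟩
      simp only [map_mul, ← h, ← h']; ring
  intro b
  obtain ⟨a₀, d₀, hd₀, h₀⟩ := hall b
  obtain ⟨a, d, g, had, ha, hd⟩ :=
    UniqueFactorizationMonoid.exists_reduced_factors' a₀ d₀ hd₀
  have hg0 : g ≠ 0 := by rintro rfl; exact hd₀ (by rw [← hd, zero_mul])
  have hd0 : d ≠ 0 := by rintro rfl; exact hd₀ (by rw [← hd, mul_zero])
  have h : f d * b = f a := by
    apply mul_left_cancel₀ ((map_ne_zero_iff f hinj).2 hg0)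
    rw [← mul_assoc, ← map_mul, ← map_mul, ha, hd, h₀]
  by_cases hu : IsUnit (f d)
  · obtain ⟨c, hc, hcd⟩ := isUnit_iff_exists_C.1 hu
    refine ⟨C c⁻¹ * a, ?_⟩
    have : f (C c⁻¹) = C c⁻¹ := f.commutes _
    rw [map_mul, ← h, hcd, this, ← mul_assoc, ← C_mul, inv_mul_cancel₀ hc, C_1, one_mul]
  exfalso
  obtain ⟨π, hπ, hπd⟩ := WfDvdMonoid.exists_irreducible_factor hu
    ((map_ne_zero_iff f hinj).2 hd0)
  have hprime : (Ideal.span {π}).IsPrime := (Ideal.span_singleton_prime hπ.ne_zero).2 hπ.prime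
  have hmem : ∀ b, b ∈ (Ideal.span {π}).comap f ↔ π ∣ f b := fun b => by
    rw [Ideal.mem_comap, Ideal.mem_span_singleton]
  have : ((Ideal.span {π}).comap f).IsPrime := Ideal.IsPrime.comap f
  -- The contraction of `(π)` contains the coprime elements `a` and `d`, so `f` sends the curve `π =
  -- 0` to a point.
  obtain ⟨α, hα⟩ := exists_X_sub_C_mem hd0 had
    ((hmem a).2 (h ▸ hπd.mul_right b)) ((hmem d).2 hπd)
  have key : ∀ i, ∃ r, f (X i) = C (α i) + π * r := fun i => by
    obtain ⟨r, hr⟩ := (hmem _).1 (hα i)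
    refine ⟨r, ?_⟩
    have : f (C (α i)) = C (α i) := f.commutes _
    rw [map_sub, this] at hr
    rw [← hr]; ring
  obtain ⟨r, hr⟩ := key 0
  obtain ⟨s, hs⟩ := key 1
  have hdvd : π ∣ C lam := by
    rw [← hJ, jac_eq]
    change π ∣ pderiv 0 (f (X 0)) * pderiv 1 (f (X 1)) - pderiv 1 (f (X 0)) * pderiv 0 (f (X 1))
    rw [hr, hs]
    simp only [map_add, pderiv_C, zero_add, Derivation.leibniz, smul_eq_mul]
    -- Modulo `π` both gradients are multiples of the gradient of `π`, so the determinant vanishes.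
    refine ⟨pderiv 0 r * (π * pderiv 1 s + s * pderiv 1 π) + r * pderiv 0 π * pderiv 1 s
      - pderiv 1 r * (π * pderiv 0 s + s * pderiv 0 π) - r * pderiv 1 π * pderiv 0 s, by ring⟩
  exact hπ.not_isUnit (isUnit_of_dvd_unit hdvd (isUnit_iff_exists_C.2 ⟨lam, hlam, rfl⟩))

/-! ### Units of `ℂ[p, q, x][1/v]` and surjectivity. -/

theorem range_eq_polyPQ (f : Poly →ₐ[ℂ] Poly) : f.range = polyPQ (f x) (f y) := by
  rw [← Algebra.map_top, ← MvPolynomial.adjoin_range_X, AlgHom.map_adjoin, ← Set.range_comp]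
  congr 1
  ext b
  simp [Fin.exists_fin_two, eq_comm]

theorem polyPQX_le_range_evalX (f : Poly →ₐ[ℂ] Poly) :
    polyPQX (f x) (f y) ≤ (evalX f).range := by
  refine Algebra.adjoin_le ?_
  rintro b (rfl | rfl | rfl)
  · exact ⟨Polynomial.C x, evalX_C f x⟩
  · exact ⟨Polynomial.C y, evalX_C f y⟩
  · exact ⟨Polynomial.X, evalX_X f⟩

theorem toRatFun_mem_ratPQ {p q b : Poly} (hb : b ∈ polyPQ p q) : toRatFun b ∈ ratPQ p q := by
  have hle : polyPQ p q ≤ (ratPQ p q).toSubalgebra.comap (IsScalarTower.toAlgHom ℂ Poly RatFun) := by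
    refine Algebra.adjoin_le ?_
    rintro b (rfl | rfl)
    · exact IntermediateField.subset_adjoin ℂ _ (Set.mem_insert _ _)
    · exact IntermediateField.subset_adjoin ℂ _ (Set.mem_insert_of_mem _ rfl)
  exact hle hb

theorem exists_pow_mul_eq {p q v : Poly} (hv : v ≠ 0) {a : RatFun} (ha : a ∈ polyPQXInv p q v) :
    ∃ n b, toRatFun v ^ n * a = toRatFun b := by
  have hv' : toRatFun v ≠ 0 := by simpa using hv
  induction ha using Algebra.adjoin_induction with
  | mem a h =>
    rcases h with rfl | rfl | rfl | rfl
    · exact ⟨0, p, by simp⟩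
    · exact ⟨0, q, by simp⟩
    · exact ⟨0, x, by simp⟩
    · exact ⟨1, 1, by simp [hv]⟩
  | algebraMap r =>
    exact ⟨0, algebraMap ℂ Poly r, by
      rw [pow_zero, one_mul, toRatFun, ← IsScalarTower.algebraMap_apply]⟩
  | add a a' _ _ h h' =>
    obtain ⟨n, b, h⟩ := h
    obtain ⟨n', b', h'⟩ := h'
    refine ⟨n + n', v ^ n' * b + v ^ n * b', ?_⟩
    simp only [toRatFun, map_add, map_mul, map_pow] at *
    rw [← h, ← h']; ring
  | mul a a' _ _ h h' =>
    obtain ⟨n, b, h⟩ := h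
    obtain ⟨n', b', h'⟩ := h'
    refine ⟨n + n', b * b', ?_⟩
    simp only [toRatFun, map_mul] at *
    rw [← h, ← h']; ring

/-- Clearing denominators in a unit and its inverse gives polynomials whose product is a power of
`v`; both therefore divide it. -/
theorem unitCondition_of_dvd_pow_mem {p q v : Poly} (hv : v ≠ 0) (hvA : v ∈ polyPQ p q)
    (hdvd : ∀ n b, b ∣ v ^ n → b ∈ polyPQ p q) : UnitCondition p q v := by
  intro a
  have hinj : Function.Injective (algebraMap Poly RatFun) := IsFractionRing.injective _ _
  have hv' : toRatFun v ≠ 0 := by simpa using hv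
  have haa : ((a : polyPQXInv p q v) : RatFun) * ((a⁻¹ : (polyPQXInv p q v)ˣ) : polyPQXInv p q v)
      = 1 := by
    rw [← MulMemClass.coe_mul, Units.mul_inv]; rfl
  refine ⟨?_, left_ne_zero_of_mul_eq_one haa⟩
  obtain ⟨n, b, hb⟩ := exists_pow_mul_eq hv (a : polyPQXInv p q v).2
  obtain ⟨n', b', hb'⟩ := exists_pow_mul_eq hv ((a⁻¹ : (polyPQXInv p q v)ˣ) : polyPQXInv p q v).2
  have hbb : b * b' = v ^ (n + n') := by
    apply hinj
    rw [map_mul, map_pow, ← toRatFun, ← toRatFun, ← hb, ← hb', pow_add]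
    linear_combination (toRatFun v ^ n * toRatFun v ^ n') * haa
  have hmem := toRatFun_mem_ratPQ (hdvd _ b ⟨b', hbb.symm⟩)
  have : ((a : polyPQXInv p q v) : RatFun) = toRatFun b * (toRatFun v ^ n)⁻¹ := by
    rw [← hb]; field_simp
  rw [this]
  exact mul_mem hmem (inv_mem (pow_mem (toRatFun_mem_ratPQ hvA) n))

theorem surjective_of_dvd_pow_mem {f : Poly →ₐ[ℂ] Poly} {lam : ℂ} (hlam : lam ≠ 0)
    (hJ : jac (f x) (f y) = C lam) {V : Poly} (hV : V ≠ 0) {U : Polynomial Poly}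
    (hU : evalX f U = f V * y) (hdvd : ∀ n b, b ∣ f V ^ n → b ∈ f.range) :
    Function.Surjective f := by
  have hinj := injective_of_jac hlam hJ
  obtain ⟨G, hGp, hdeg, hG⟩ := exists_ker_generator (evalX f : Polynomial Poly →+* Poly)
    (fun r hr => (map_eq_zero_iff f hinj).1 ((evalX_C f r).symm.trans hr))
    (not_injective_of_polynomial (evalX f))
  replace hG : ∀ H, evalX f H = 0 ↔ G ∣ H := hG
  obtain ⟨n, hn⟩ := evalX_derivative_dvd_pow hlam hJ hGp.ne_zero hG
    ((map_ne_zero_iff f hinj).2 hV) hU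
  obtain ⟨e, he⟩ := hdvd n _ hn
  replace he : f e = evalX f (Polynomial.derivative G) := he
  -- The difference is a multiple of `G` of smaller degree, hence zero.
  have hGe : Polynomial.derivative G = Polynomial.C e := by
    rw [← sub_eq_zero]
    refine Polynomial.eq_zero_of_dvd_of_natDegree_lt
      ((hG _).1 (by rw [map_sub, evalX_C, he, sub_self])) ?_
    rw [Polynomial.natDegree_sub_C]
    exact Polynomial.natDegree_derivative_lt hdeg
  have hdeg1 : G.natDegree = 1 := by
    have := Polynomial.natDegree_derivative G
    rw [hGe, Polynomial.natDegree_C] at this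
    omega
  obtain ⟨a, ha, b, hab⟩ := Polynomial.natDegree_eq_one.1 hdeg1
  have hx : f a * x = f (-b) := by
    have := (hG G).2 dvd_rfl
    rw [← hab, map_add, map_mul, evalX_C, evalX_C, evalX_X] at this
    rw [map_neg]; linear_combination this
  -- As `x = f (-b) / f a`, all of `ℂ[p, q, x]` lies in `ℂ(p, q)`; applied to `U` this covers `y`.
  have hrange : ∀ H, ∃ c d, d ≠ 0 ∧ f d * evalX f H = f c := by
    intro H
    induction H using Polynomial.induction_on with
    | C c => exact ⟨c, 1, one_ne_zero, by simp⟩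
    | add H H' h h' =>
      obtain ⟨c, d, hd, h⟩ := h
      obtain ⟨c', d', hd', h'⟩ := h'
      refine ⟨c * d' + c' * d, d * d', mul_ne_zero hd hd', ?_⟩
      simp only [map_add, map_mul, ← h, ← h']; ring
    | monomial n c h =>
      obtain ⟨c', d, hd, h⟩ := h
      refine ⟨c' * -b, d * a, mul_ne_zero hd ha, ?_⟩
      rw [pow_succ, ← mul_assoc, map_mul (evalX f), evalX_X, map_mul f, map_mul f, ← h, ← hx]; ring
  obtain ⟨c, d, hd, h⟩ := hrange U
  exact surjective_of_birational hlam hJ ⟨-b, a, ha, hx⟩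
    ⟨c, d * V, mul_ne_zero hd hV, by rw [map_mul, ← h, hU]; ring⟩

end JacPlane

theorem mainTheorem5
    (f : JacPlane.Poly →ₐ[ℂ] JacPlane.Poly)
    (p q : JacPlane.Poly) (hp : p = f JacPlane.x) (hq : q = f JacPlane.y)
    (hJac : ∃ lam : ℂ, lam ≠ 0 ∧ JacPlane.jac p q = MvPolynomial.C lam)
    (u : JacPlane.polyPQX p q) (hu : u ≠ 0)
    (v : JacPlane.polyPQ p q) (hv : v ≠ 0)
    (huv : JacPlane.toRatFun JacPlane.y =
      JacPlane.toRatFun (u : JacPlane.Poly) / JacPlane.toRatFun (v : JacPlane.Poly))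
    (c : ℂ) (hc : c ≠ 0) (m : ℕ) (w : Fin m → JacPlane.polyPQ p q)
    (hw : ∀ j, Irreducible (w j))
    (hvw : v = algebraMap ℂ (JacPlane.polyPQ p q) c * ∏ j, w j)
    (hirr : ∀ j, Irreducible (w j : JacPlane.Poly)) :
    JacPlane.UnitCondition p q (v : JacPlane.Poly) ∧ Function.Bijective f := by
  subst hp hq
  obtain ⟨lam, hlam, hJ⟩ := hJac
  have hv0 : (v : JacPlane.Poly) ≠ 0 := fun h => hv (Subtype.ext h)
  have hveq : (v : JacPlane.Poly) = MvPolynomial.C c * ∏ j, (w j : JacPlane.Poly) := by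
    rw [hvw, MulMemClass.coe_mul, SubmonoidClass.coe_finsetProd]
    rfl
  have hdvd : ∀ n b, b ∣ (v : JacPlane.Poly) ^ n →
      b ∈ JacPlane.polyPQ (f JacPlane.x) (f JacPlane.y) := by
    rw [hveq]
    exact fun n => JacPlane.mem_of_dvd_pow hc hirr (fun j => (w j).2) n
  refine ⟨JacPlane.unitCondition_of_dvd_pow_mem hv0 v.2 hdvd,
    JacPlane.injective_of_jac hlam hJ, ?_⟩
  obtain ⟨V, hV⟩ : (v : JacPlane.Poly) ∈ f.range := by
    rw [JacPlane.range_eq_polyPQ]; exact v.2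
  replace hV : f V = v := hV
  obtain ⟨U, hU⟩ := JacPlane.polyPQX_le_range_evalX f u.2
  replace hU : JacPlane.evalX f U = u := hU
  rw [← hV] at hv0 huv
  have hdvd' : ∀ n b, b ∣ f V ^ n → b ∈ f.range := fun n b hb => by
    rw [JacPlane.range_eq_polyPQ]
    exact hdvd n b (hV ▸ hb)
  refine JacPlane.surjective_of_dvd_pow_mem hlam hJ (fun h => hv0 (by rw [h, map_zero])) (U := U)
    ?_ hdvd'
  have hinj : Function.Injective (algebraMap JacPlane.Poly JacPlane.RatFun) :=
    IsFractionRing.injective _ _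
  apply hinj
  rw [eq_div_iff ((map_ne_zero_iff _ hinj).2 hv0)] at huv
  rw [hU, map_mul, mul_comm]
  exact huv.symm
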